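/- Let $K$ be an algebraically closed field, let $C$ be a $K$-coalgebra, and let $e$ be an idempotent of the dual (convolution) algebra $C^*$, where $(fg)(x)=\sum f(x_{(1)})g(x_{(2)})$. Write $ex=\sum x_{(1)}e(x_{(2)})$ and $xe=\sum e(x_{(1)})x_{(2)}$ for $x\in C$, and let $eCe=\{exe : x\in C\}$ be the coalgebra with comultiplication $\Delta_{eCe}(exe)=\sum ex_{(1)}e\otimes ex_{(2)}e$ and with counit the restriction of $\varepsilon_C$ to $eCe$. For a coalgebra $D$ let $\mathcal M^D$ and $\mathcal M^D_f$ be the categories of right $D$-comodules and of finite-dimensional right $D$-comodules. For a right $C$-comodule $M$ put $em=\sum m_{(0)}e(m_{(1)})$; then $eM$ is a right $eCe$-comodule with coaction $em\mapsto\sum em_{(0)}\otimes em_{(1)}e$. The functor $T=e(-):\mathcal M^C\to\mathcal M^{eCe}$, $M\mapsto eM$, is the quotient functor of $\mathcal M^C$ by the localizing subcategory $\{M : eM=0\}$. We say that $e$ defines a perfect colocalization if $T$ has a left adjoint $H:\mathcal M^{eCe}\to\mathcal M^C$ and $H$ is exact. Let $Q$ be the quiver with two vertices and exactly three arrows, all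 going from the first vertex to the second, and let $\mathcal M^f_{KQ}$ be the category of finite-dimensional right modules over the path algebra $KQ$. A $K$-coalgebra $D$ is of wild comodule type if there is an exact and faithful $K$-linear functor $F:\mathcal M^f_{KQ}\to\mathcal M^D_f$ that respects isomorphism classes (if $F(X)\cong F(Y)$ then $X\cong Y$) and carries indecomposable modules to indecomposable comodules. Proposition. If $e$ defines a perfect colocalization and $eCe$ is of wild comodule type, then $C$ is of wild comodule type. -/

import Mathlib

open CategoryTheory CategoryTheory.Limits
open scoped TensorProduct

universe u

noncomputable section

/-! ### Right comodules over a coalgebra -/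

/-- A right comodule over the `K`-coalgebra `C`: a `K`-vector space `M` with a linear map
`ρ : M → M ⊗ C` such that `(ρ ⊗ id) ρ = (id ⊗ Δ) ρ` and `(id ⊗ ε) ρ = id`. -/
structure RightComodule (K C : Type u) [Field K] [AddCommGroup C] [Module K C]
    [Coalgebra K C] : Type (u + 1) where
  /-- the underlying vector space -/
  carrier : Type u
  [addCommGroup : AddCommGroup carrier]
  [module : Module K carrier]
  /-- the coaction -/
  coact : carrier →ₗ[K] carrier ⊗[K] C
  coassoc : (TensorProduct.assoc K carrier C C).toLinearMap ∘ₗ coact.rTensor C ∘ₗ coact =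
    (Coalgebra.comul (R := K) (A := C)).lTensor carrier ∘ₗ coact
  lTensor_counit_comp_coact : (Coalgebra.counit (R := K) (A := C)).lTensor carrier ∘ₗ coact =
    (TensorProduct.mk K carrier K).flip 1

namespace RightComodule

attribute [instance] RightComodule.addCommGroup RightComodule.module

section Basic

variable {K C : Type u} [Field K] [AddCommGroup C] [Module K C] [Coalgebra K C]

/-- The space of comodule homomorphisms: linear maps `f` with `(f ⊗ id) ρ_M = ρ_N f`. -/
def homSubmodule (M N : RightComodule K C) : Submodule K (M.carrier →ₗ[K] N.carrier) where
  carrier := {f | f.rTensor C ∘ₗ M.coact = N.coact ∘ₗ f}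
  add_mem' {f g} hf hg := by
    simp only [Set.mem_ofPred_eq] at hf hg ⊢
    rw [LinearMap.rTensor_add, LinearMap.add_comp, LinearMap.comp_add, hf, hg]
  zero_mem' := by simp
  smul_mem' r f hf := by
    simp only [Set.mem_ofPred_eq] at hf ⊢
    rw [LinearMap.rTensor_smul, LinearMap.smul_comp, LinearMap.comp_smul, hf]

/-- The category `𝓜^C` of right `C`-comodules. -/
instance : Category (RightComodule K C) where
  Hom M N := homSubmodule M N
  id M := ⟨LinearMap.id, by simp [homSubmodule]⟩
  comp f g := ⟨g.1 ∘ₗ f.1, by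
    have hf : f.1.rTensor C ∘ₗ _ = _ ∘ₗ f.1 := f.2
    have hg : g.1.rTensor C ∘ₗ _ = _ ∘ₗ g.1 := g.2
    change (g.1 ∘ₗ f.1).rTensor C ∘ₗ _ = _ ∘ₗ (g.1 ∘ₗ f.1)
    rw [LinearMap.rTensor_comp, LinearMap.comp_assoc, hf, ← LinearMap.comp_assoc, hg,
      LinearMap.comp_assoc]⟩

/-- The underlying linear map of a morphism of comodules. -/
def Hom.lin {M N : RightComodule K C} (f : M ⟶ N) : M.carrier →ₗ[K] N.carrier :=
  Subtype.val (p := fun g => g ∈ homSubmodule M N) f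

lemma Hom.lin_injective {M N : RightComodule K C} {f g : M ⟶ N} (h : Hom.lin f = Hom.lin g) :
    f = g :=
  Subtype.ext h

instance : Preadditive (RightComodule K C) where
  homGroup M N := inferInstanceAs (AddCommGroup (homSubmodule M N))
  add_comp _ _ _ f g h := Subtype.ext (LinearMap.comp_add f.1 g.1 h.1)
  comp_add _ _ _ f g h := Subtype.ext (LinearMap.add_comp f.1 h.1 g.1)

instance : Linear K (RightComodule K C) where
  homModule M N := inferInstanceAs (Module K (homSubmodule M N))
  smul_comp _ _ _ r f g := Subtype.ext (LinearMap.comp_smul g.1 r f.1)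
  comp_smul _ _ _ f r g := Subtype.ext (LinearMap.smul_comp r g.1 f.1)

end Basic

/-- `0 → X → Y → Z → 0` is an exact sequence of comodules, that is, an exact sequence of the
underlying vector spaces. -/
def IsShortExact {K C : Type u} [Field K] [AddCommGroup C] [Module K C] [Coalgebra K C]
    {X Y Z : RightComodule K C} (f : X ⟶ Y) (g : Y ⟶ Z) : Prop :=
  Function.Injective (Hom.lin f) ∧ Function.Exact (Hom.lin f) (Hom.lin g) ∧
    Function.Surjective (Hom.lin g)

/-- The finite-dimensional comodules. -/
def isFiniteDimensional (K C : Type u) [Field K] [AddCommGroup C] [Module K C]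
    [Coalgebra K C] : ObjectProperty (RightComodule K C) :=
  fun M => FiniteDimensional K M.carrier

/-- The category `𝓜_f^C` of finite-dimensional right `C`-comodules. -/
abbrev FinDim (K C : Type u) [Field K] [AddCommGroup C] [Module K C] [Coalgebra K C] :
    Type (u + 1) :=
  (isFiniteDimensional K C).FullSubcategory

end RightComodule

/-! ### The coalgebra `eCe` of an idempotent `e` of the dual algebra `C^*`

The dual algebra `C^*` is `WithConv (C →ₗ[K] K)`, with the convolution product. -/

lemma assoc_slice {K C M : Type u} [Field K] [AddCommGroup C] [Module K C]
    [AddCommGroup M] [Module K M] (φ : C →ₗ[K] K)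
    (t : M ⊗[K] C) (c : C) :
    ((TensorProduct.rid K C).toLinearMap ∘ₗ φ.lTensor C).lTensor M
      (TensorProduct.assoc K M C C (t ⊗ₜ[K] c)) = φ c • t := by
  induction t with
  | zero => simp
  | tmul m d => simp
  | add x y hx hy => simp only [TensorProduct.add_tmul, map_add, hx, hy, smul_add]

lemma assoc_symm_slice {K C : Type u} [Field K] [AddCommGroup C] [Module K C]
    (φ : C →ₗ[K] K) (t : C ⊗[K] C) (c : C) :
    ((TensorProduct.lid K C).toLinearMap ∘ₗ φ.rTensor C).rTensor C
      ((TensorProduct.assoc K C C C).symm (c ⊗ₜ[K] t)) = φ c • t := by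
  induction t with
  | zero => simp
  | tmul m d => simp [TensorProduct.smul_tmul']
  | add x y hx hy => simp only [TensorProduct.tmul_add, map_add, hx, hy, smul_add]

section Localized

variable {K C : Type u} [Field K] [AddCommGroup C] [Module K C] [Coalgebra K C]

/-- `x ↦ e x = ∑ x₁ e(x₂)` on `C`. -/
def dualLeft (e : WithConv (C →ₗ[K] K)) : C →ₗ[K] C :=
  (TensorProduct.rid K C).toLinearMap ∘ₗ e.ofConv.lTensor C ∘ₗ Coalgebra.comul

/-- `x ↦ x e = ∑ e(x₁) x₂` on `C`. -/
def dualRight (e : WithConv (C →ₗ[K] K)) : C →ₗ[K] C :=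
  (TensorProduct.lid K C).toLinearMap ∘ₗ e.ofConv.rTensor C ∘ₗ Coalgebra.comul

/-- `x ↦ e x e` on `C`. -/
def dualSandwich (e : WithConv (C →ₗ[K] K)) : C →ₗ[K] C :=
  dualRight e ∘ₗ dualLeft e

/-- `m ↦ e m = ∑ m₀ e(m₁)` on a right comodule `M`. -/
def RightComodule.act (e : WithConv (C →ₗ[K] K)) (M : RightComodule K C) :
    M.carrier →ₗ[K] M.carrier :=
  (TensorProduct.rid K M.carrier).toLinearMap ∘ₗ e.ofConv.lTensor M.carrier ∘ₗ M.coact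

variable (e : WithConv (C →ₗ[K] K))

lemma RightComodule.coact_comp_act (M : RightComodule K C) :
    M.coact ∘ₗ RightComodule.act e M = (dualLeft e).lTensor M.carrier ∘ₗ M.coact := by
  have h : M.coact ∘ₗ (TensorProduct.rid K M.carrier).toLinearMap ∘ₗ
      e.ofConv.lTensor M.carrier =
      ((TensorProduct.rid K C).toLinearMap ∘ₗ e.ofConv.lTensor C).lTensor M.carrier ∘ₗ
        (TensorProduct.assoc K M.carrier C C).toLinearMap ∘ₗ M.coact.rTensor C := by
    refine TensorProduct.ext' fun m c => ?_
    have := assoc_slice e.ofConv (M.coact m) c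
    simp only [LinearMap.comp_apply, LinearEquiv.coe_coe, LinearMap.rTensor_tmul] at this ⊢
    rw [this]
    simp
  have h2 := congrArg (fun f => f ∘ₗ M.coact) h
  simp only [LinearMap.comp_assoc] at h2
  rw [M.coassoc] at h2
  rw [RightComodule.act, h2, dualLeft, ← LinearMap.comp_assoc, ← LinearMap.lTensor_comp,
    LinearMap.comp_assoc]

/-- The coalgebra `C` as a right comodule over itself. -/
def RightComodule.regular (K C : Type u) [Field K] [AddCommGroup C] [Module K C]
    [Coalgebra K C] : RightComodule K C where
  carrier := C
  coact := Coalgebra.comul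
  coassoc := Coalgebra.coassoc
  lTensor_counit_comp_coact := Coalgebra.lTensor_counit_comp_comul

lemma comul_comp_dualLeft :
    Coalgebra.comul ∘ₗ dualLeft e = (dualLeft e).lTensor C ∘ₗ Coalgebra.comul :=
  RightComodule.coact_comp_act e (RightComodule.regular K C)

lemma comul_comp_dualRight :
    Coalgebra.comul ∘ₗ dualRight e = (dualRight e).rTensor C ∘ₗ Coalgebra.comul := by
  have h : Coalgebra.comul ∘ₗ (TensorProduct.lid K C).toLinearMap ∘ₗ e.ofConv.rTensor C =
      ((TensorProduct.lid K C).toLinearMap ∘ₗ e.ofConv.rTensor C).rTensor C ∘ₗ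
        (TensorProduct.assoc K C C C).symm.toLinearMap ∘ₗ Coalgebra.comul.lTensor C := by
    refine TensorProduct.ext' fun c d => ?_
    have := assoc_symm_slice e.ofConv (Coalgebra.comul (R := K) d) c
    simp only [LinearMap.comp_apply, LinearEquiv.coe_coe, LinearMap.lTensor_tmul] at this ⊢
    rw [this]
    simp
  have h2 := congrArg (fun f => f ∘ₗ Coalgebra.comul) h
  simp only [LinearMap.comp_assoc] at h2
  rw [Coalgebra.coassoc_symm] at h2
  rw [dualRight, h2, ← LinearMap.comp_assoc, ← LinearMap.rTensor_comp, LinearMap.comp_assoc]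

/-! #### Idempotents: `e` acts on comodules and on `C` by projections -/

variable {e}

lemma ofConv_comp_dualLeft (he : IsIdempotentElem e) : e.ofConv ∘ₗ dualLeft e = e.ofConv := by
  ext c
  have := DFunLike.congr_fun (congrArg WithConv.ofConv he.eq) c
  rw [← this]
  simp only [LinearMap.comp_apply, dualLeft, LinearEquiv.coe_coe, LinearMap.convMul_def,
    WithConv.ofConv_toConv]
  generalize Coalgebra.comul (R := K) c = t
  induction t with
  | zero => simp
  | tmul x y => simp [mul_comm]
  | add x y hx hy => simp only [map_add, hx, hy]

lemma ofConv_comp_dualRight (he : IsIdempotentElem e) :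
    e.ofConv ∘ₗ dualRight e = e.ofConv := by
  ext c
  have := DFunLike.congr_fun (congrArg WithConv.ofConv he.eq) c
  rw [← this]
  simp only [LinearMap.comp_apply, dualRight, LinearEquiv.coe_coe, LinearMap.convMul_def,
    WithConv.ofConv_toConv]
  generalize Coalgebra.comul (R := K) c = t
  induction t with
  | zero => simp
  | tmul x y => simp
  | add x y hx hy => simp only [map_add, hx, hy]

lemma counit_comp_dualLeft (e : WithConv (C →ₗ[K] K)) :
    Coalgebra.counit ∘ₗ dualLeft e = e.ofConv := by
  have h : (Coalgebra.counit (R := K) (A := C)) ∘ₗ (TensorProduct.rid K C).toLinearMap ∘ₗ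
      e.ofConv.lTensor C = e.ofConv ∘ₗ (TensorProduct.lid K C).toLinearMap ∘ₗ
        Coalgebra.counit.rTensor C := by
    ext x y
    simp [mul_comm]
  have h2 := congrArg (fun f => f ∘ₗ Coalgebra.comul) h
  simp only [LinearMap.comp_assoc, Coalgebra.rTensor_counit_comp_comul] at h2
  rw [dualLeft, h2]
  ext x
  simp

lemma RightComodule.act_comp_act (M : RightComodule K C) (he : IsIdempotentElem e) :
    RightComodule.act e M ∘ₗ RightComodule.act e M = RightComodule.act e M := by
  conv_lhs => enter [1]; rw [RightComodule.act]
  rw [LinearMap.comp_assoc, LinearMap.comp_assoc, RightComodule.coact_comp_act,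
    ← LinearMap.comp_assoc (f := M.coact), ← LinearMap.lTensor_comp, ofConv_comp_dualLeft he]
  rfl

lemma dualLeft_comp_dualLeft (he : IsIdempotentElem e) :
    dualLeft e ∘ₗ dualLeft e = dualLeft e :=
  RightComodule.act_comp_act (RightComodule.regular K C) he

lemma dualRight_comp_dualRight (he : IsIdempotentElem e) :
    dualRight e ∘ₗ dualRight e = dualRight e := by
  conv_lhs => enter [1]; rw [dualRight]
  rw [LinearMap.comp_assoc, LinearMap.comp_assoc, comul_comp_dualRight,
    ← LinearMap.comp_assoc (f := Coalgebra.comul), ← LinearMap.rTensor_comp,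
    ofConv_comp_dualRight he]
  rfl

lemma dualLeft_comp_dualRight (e : WithConv (C →ₗ[K] K)) :
    dualLeft e ∘ₗ dualRight e = dualRight e ∘ₗ dualLeft e := by
  have h : (TensorProduct.rid K C).toLinearMap ∘ₗ e.ofConv.lTensor C ∘ₗ
      (dualRight e).rTensor C = dualRight e ∘ₗ (TensorProduct.rid K C).toLinearMap ∘ₗ
        e.ofConv.lTensor C := by
    ext x y
    simp
  have h2 := congrArg (fun f => f ∘ₗ Coalgebra.comul) h
  simp only [LinearMap.comp_assoc] at h2
  conv_lhs => enter [1]; rw [dualLeft]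
  rw [LinearMap.comp_assoc, LinearMap.comp_assoc, comul_comp_dualRight, h2, dualLeft]

lemma dualSandwich_comp_dualLeft (he : IsIdempotentElem e) :
    dualSandwich e ∘ₗ dualLeft e = dualSandwich e := by
  rw [dualSandwich, LinearMap.comp_assoc, dualLeft_comp_dualLeft he]

lemma dualSandwich_comp_dualRight (he : IsIdempotentElem e) :
    dualSandwich e ∘ₗ dualRight e = dualSandwich e := by
  rw [dualSandwich, LinearMap.comp_assoc, dualLeft_comp_dualRight, ← LinearMap.comp_assoc,
    dualRight_comp_dualRight he]

lemma dualSandwich_comp_dualSandwich (he : IsIdempotentElem e) :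
    dualSandwich e ∘ₗ dualSandwich e = dualSandwich e := by
  conv_lhs => enter [2]; rw [dualSandwich]
  rw [← LinearMap.comp_assoc, dualSandwich_comp_dualRight he, dualSandwich_comp_dualLeft he]

lemma counit_comp_dualSandwich (he : IsIdempotentElem e) :
    Coalgebra.counit ∘ₗ dualSandwich e = e.ofConv := by
  rw [dualSandwich, ← dualLeft_comp_dualRight, ← LinearMap.comp_assoc, counit_comp_dualLeft,
    ofConv_comp_dualRight he]

end Localized

/-- The subspace `eCe` of `C`, for an idempotent `e` of `C^*`. -/
def LocalizedCoalgebra {K C : Type u} [Field K] [AddCommGroup C] [Module K C] [Coalgebra K C]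
    (e : WithConv (C →ₗ[K] K)) (_he : IsIdempotentElem e) : Type u :=
  LinearMap.range (dualSandwich e)

namespace LocalizedCoalgebra

variable {K C : Type u} [Field K] [AddCommGroup C] [Module K C] [Coalgebra K C]
  {e : WithConv (C →ₗ[K] K)} (he : IsIdempotentElem e)

instance : AddCommGroup (LocalizedCoalgebra e he) :=
  inferInstanceAs (AddCommGroup (LinearMap.range (dualSandwich e)))

instance : Module K (LocalizedCoalgebra e he) :=
  inferInstanceAs (Module K (LinearMap.range (dualSandwich e)))

/-- The inclusion `eCe → C`. -/
def incl : LocalizedCoalgebra e he →ₗ[K] C :=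
  (LinearMap.range (dualSandwich e)).subtype

/-- The projection `C → eCe`, `x ↦ e x e`. -/
def proj : C →ₗ[K] LocalizedCoalgebra e he :=
  (dualSandwich e).rangeRestrict

lemma incl_injective : Function.Injective (incl he) :=
  Subtype.val_injective

lemma incl_comp_proj : incl he ∘ₗ proj he = dualSandwich e := rfl

lemma proj_comp_incl : proj he ∘ₗ incl he = LinearMap.id := by
  ext x
  obtain ⟨_, y, rfl⟩ := x
  exact incl_injective he (DFunLike.congr_fun (dualSandwich_comp_dualSandwich he) y)

lemma proj_comp_dualLeft : proj he ∘ₗ dualLeft e = proj he := by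
  ext x
  exact incl_injective he (DFunLike.congr_fun (dualSandwich_comp_dualLeft he) x)

lemma proj_comp_dualRight : proj he ∘ₗ dualRight e = proj he := by
  ext x
  exact incl_injective he (DFunLike.congr_fun (dualSandwich_comp_dualRight he) x)

/-- `Δ_{eCe}` and `ε_{eCe}`: `Δ(exe) = ∑ e x₁ e ⊗ e x₂ e`, and the counit is the restriction
of the counit of `C`. -/
instance : CoalgebraStruct K (LocalizedCoalgebra e he) where
  comul := TensorProduct.map (proj he) (proj he) ∘ₗ Coalgebra.comul ∘ₗ incl he
  counit := Coalgebra.counit ∘ₗ incl he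

lemma comul_def : (Coalgebra.comul : LocalizedCoalgebra e he →ₗ[K] _) =
    TensorProduct.map (proj he) (proj he) ∘ₗ Coalgebra.comul ∘ₗ incl he := rfl

lemma counit_def : (Coalgebra.counit : LocalizedCoalgebra e he →ₗ[K] K) =
    Coalgebra.counit ∘ₗ incl he := rfl

lemma comul_comp_proj : Coalgebra.comul ∘ₗ proj he =
    TensorProduct.map (proj he) (proj he) ∘ₗ Coalgebra.comul := by
  rw [comul_def, LinearMap.comp_assoc, LinearMap.comp_assoc, incl_comp_proj, dualSandwich,
    ← LinearMap.comp_assoc (f := dualLeft e), comul_comp_dualRight, LinearMap.comp_assoc,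
    comul_comp_dualLeft, ← LinearMap.comp_assoc, ← LinearMap.comp_assoc,
    LinearMap.map_comp_rTensor, LinearMap.map_comp_lTensor, proj_comp_dualLeft,
    proj_comp_dualRight]

lemma counit_comp_proj : Coalgebra.counit ∘ₗ proj he = e.ofConv := by
  rw [counit_def, LinearMap.comp_assoc, incl_comp_proj, counit_comp_dualSandwich he]

/-- The coalgebra `eCe`. -/
instance : Coalgebra K (LocalizedCoalgebra e he) where
  coassoc := by
    set q := proj he
    have h1 : (Coalgebra.comul (R := K) (A := LocalizedCoalgebra e he)).rTensor _ ∘ₗ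
        TensorProduct.map q q =
        TensorProduct.map (TensorProduct.map q q) q ∘ₗ
          (Coalgebra.comul (R := K) (A := C)).rTensor C := by
      rw [LinearMap.rTensor_comp_map, comul_comp_proj, LinearMap.map_comp_rTensor]
    have h2 : (Coalgebra.comul (R := K) (A := LocalizedCoalgebra e he)).lTensor _ ∘ₗ
        TensorProduct.map q q =
        TensorProduct.map q (TensorProduct.map q q) ∘ₗ
          (Coalgebra.comul (R := K) (A := C)).lTensor C := by
      rw [LinearMap.lTensor_comp_map, comul_comp_proj, LinearMap.map_comp_lTensor]
    have h3 : (TensorProduct.assoc K _ _ _).toLinearMap ∘ₗ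
        TensorProduct.map (TensorProduct.map q q) q =
        TensorProduct.map q (TensorProduct.map q q) ∘ₗ
          (TensorProduct.assoc K C C C).toLinearMap := by
      ext x y z
      simp
    calc _ = (TensorProduct.assoc K _ _ _).toLinearMap ∘ₗ
          ((Coalgebra.comul (R := K) (A := LocalizedCoalgebra e he)).rTensor _ ∘ₗ
            TensorProduct.map q q) ∘ₗ Coalgebra.comul ∘ₗ incl he := rfl
      _ = ((TensorProduct.assoc K _ _ _).toLinearMap ∘ₗ
          TensorProduct.map (TensorProduct.map q q) q) ∘ₗ
            (Coalgebra.comul (R := K) (A := C)).rTensor C ∘ₗ Coalgebra.comul ∘ₗ incl he := by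
        rw [h1]; rfl
      _ = TensorProduct.map q (TensorProduct.map q q) ∘ₗ
          ((TensorProduct.assoc K C C C).toLinearMap ∘ₗ
            (Coalgebra.comul (R := K) (A := C)).rTensor C ∘ₗ Coalgebra.comul) ∘ₗ incl he := by
        rw [h3]; rfl
      _ = (TensorProduct.map q (TensorProduct.map q q) ∘ₗ
          (Coalgebra.comul (R := K) (A := C)).lTensor C) ∘ₗ Coalgebra.comul ∘ₗ incl he := by
        rw [Coalgebra.coassoc]; rfl
      _ = _ := by rw [← h2]; rfl
  rTensor_counit_comp_comul := by
    have h : (TensorProduct.lid K _).toLinearMap ∘ₗ TensorProduct.map e.ofConv (proj he) =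
        proj he ∘ₗ (TensorProduct.lid K _).toLinearMap ∘ₗ e.ofConv.rTensor C := by
      ext x y
      simp
    have h' : (TensorProduct.lid K _).toLinearMap ∘ₗ
        (Coalgebra.counit (R := K) (A := LocalizedCoalgebra e he)).rTensor _ ∘ₗ
          Coalgebra.comul = LinearMap.id := by
      rw [comul_def, ← LinearMap.comp_assoc (Coalgebra.comul ∘ₗ _), LinearMap.rTensor_comp_map,
        counit_comp_proj, ← LinearMap.comp_assoc, h]
      calc _ = (proj he ∘ₗ dualRight e) ∘ₗ incl he := rfl
        _ = _ := by rw [proj_comp_dualRight, proj_comp_incl]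
    ext1 x
    apply (TensorProduct.lid K _).injective
    simpa using DFunLike.congr_fun h' x
  lTensor_counit_comp_comul := by
    have h : (TensorProduct.rid K _).toLinearMap ∘ₗ TensorProduct.map (proj he) e.ofConv =
        proj he ∘ₗ (TensorProduct.rid K _).toLinearMap ∘ₗ e.ofConv.lTensor C := by
      ext x y
      simp
    have h' : (TensorProduct.rid K _).toLinearMap ∘ₗ
        (Coalgebra.counit (R := K) (A := LocalizedCoalgebra e he)).lTensor _ ∘ₗ
          Coalgebra.comul = LinearMap.id := by
      rw [comul_def, ← LinearMap.comp_assoc (Coalgebra.comul ∘ₗ _), LinearMap.lTensor_comp_map,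
        counit_comp_proj, ← LinearMap.comp_assoc, h]
      calc _ = (proj he ∘ₗ dualLeft e) ∘ₗ incl he := rfl
        _ = _ := by rw [proj_comp_dualLeft, proj_comp_incl]
    ext1 x
    apply (TensorProduct.rid K _).injective
    simpa using DFunLike.congr_fun h' x

end LocalizedCoalgebra

namespace RightComodule

variable {K C : Type u} [Field K] [AddCommGroup C] [Module K C] [Coalgebra K C]
  {e : WithConv (C →ₗ[K] K)} (he : IsIdempotentElem e) (M : RightComodule K C)

/-- The inclusion `eM → M`. -/
def locIncl (e : WithConv (C →ₗ[K] K)) : LinearMap.range (act e M) →ₗ[K] M.carrier :=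
  (LinearMap.range (act e M)).subtype

/-- The projection `M → eM`, `m ↦ e m`. -/
def locProj (e : WithConv (C →ₗ[K] K)) : M.carrier →ₗ[K] LinearMap.range (act e M) :=
  (act e M).rangeRestrict

lemma locIncl_comp_locProj : M.locIncl e ∘ₗ M.locProj e = act e M := rfl

lemma locProj_comp_locIncl (he : IsIdempotentElem e) (M : RightComodule K C) : M.locProj e ∘ₗ M.locIncl e = LinearMap.id := by
  ext x
  obtain ⟨_, y, rfl⟩ := x
  exact DFunLike.congr_fun (M.act_comp_act he) y

/-- The coaction of `eM`: `ρ(em) = ∑ e m₀ ⊗ e m₁ e`. -/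
def locCoact : LinearMap.range (act e M) →ₗ[K]
    LinearMap.range (act e M) ⊗[K] LocalizedCoalgebra e he :=
  TensorProduct.map (M.locProj e) (LocalizedCoalgebra.proj he) ∘ₗ M.coact ∘ₗ M.locIncl e

lemma locCoact_comp_locProj : M.locCoact he ∘ₗ M.locProj e =
    TensorProduct.map (M.locProj e) (LocalizedCoalgebra.proj he) ∘ₗ M.coact := by
  rw [locCoact, LinearMap.comp_assoc, LinearMap.comp_assoc, locIncl_comp_locProj,
    coact_comp_act, ← LinearMap.comp_assoc, LinearMap.map_comp_lTensor,
    LocalizedCoalgebra.proj_comp_dualLeft]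

lemma locCoact_coassoc :
    (TensorProduct.assoc K _ _ _).toLinearMap ∘ₗ
        (M.locCoact he).rTensor (LocalizedCoalgebra e he) ∘ₗ M.locCoact he =
      (Coalgebra.comul (R := K) (A := LocalizedCoalgebra e he)).lTensor _ ∘ₗ
        M.locCoact he := by
  set q := LocalizedCoalgebra.proj he
  set p := M.locProj e
  have h1 : (M.locCoact he).rTensor (LocalizedCoalgebra e he) ∘ₗ TensorProduct.map p q =
      TensorProduct.map (TensorProduct.map p q) q ∘ₗ M.coact.rTensor C := by
    rw [LinearMap.rTensor_comp_map, locCoact_comp_locProj, LinearMap.map_comp_rTensor]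
  have h2 : (Coalgebra.comul (R := K) (A := LocalizedCoalgebra e he)).lTensor _ ∘ₗ
      TensorProduct.map p q =
      TensorProduct.map p (TensorProduct.map q q) ∘ₗ
        (Coalgebra.comul (R := K) (A := C)).lTensor M.carrier := by
    rw [LinearMap.lTensor_comp_map, LocalizedCoalgebra.comul_comp_proj,
      LinearMap.map_comp_lTensor]
  have h3 : (TensorProduct.assoc K _ _ _).toLinearMap ∘ₗ
      TensorProduct.map (TensorProduct.map p q) q =
      TensorProduct.map p (TensorProduct.map q q) ∘ₗ
        (TensorProduct.assoc K M.carrier C C).toLinearMap := by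
    ext x y z
    simp
  calc _ = (TensorProduct.assoc K _ _ _).toLinearMap ∘ₗ
        ((M.locCoact he).rTensor (LocalizedCoalgebra e he) ∘ₗ TensorProduct.map p q) ∘ₗ
          M.coact ∘ₗ M.locIncl e := rfl
    _ = ((TensorProduct.assoc K _ _ _).toLinearMap ∘ₗ
        TensorProduct.map (TensorProduct.map p q) q) ∘ₗ M.coact.rTensor C ∘ₗ
          M.coact ∘ₗ M.locIncl e := by rw [h1]; rfl
    _ = TensorProduct.map p (TensorProduct.map q q) ∘ₗ
        ((TensorProduct.assoc K M.carrier C C).toLinearMap ∘ₗ M.coact.rTensor C ∘ₗ M.coact) ∘ₗ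
          M.locIncl e := by rw [h3]; rfl
    _ = (TensorProduct.map p (TensorProduct.map q q) ∘ₗ
        (Coalgebra.comul (R := K) (A := C)).lTensor M.carrier) ∘ₗ M.coact ∘ₗ M.locIncl e := by
      rw [M.coassoc]; rfl
    _ = _ := by rw [← h2]; rfl

lemma locCoact_counit :
    (Coalgebra.counit (R := K) (A := LocalizedCoalgebra e he)).lTensor _ ∘ₗ M.locCoact he =
      (TensorProduct.mk K _ K).flip 1 := by
  have h : (TensorProduct.rid K _).toLinearMap ∘ₗ TensorProduct.map (M.locProj e) e.ofConv =
      M.locProj e ∘ₗ (TensorProduct.rid K _).toLinearMap ∘ₗ e.ofConv.lTensor M.carrier := by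
    ext x y
    simp
  have h' : (TensorProduct.rid K _).toLinearMap ∘ₗ
      (Coalgebra.counit (R := K) (A := LocalizedCoalgebra e he)).lTensor _ ∘ₗ M.locCoact he =
      LinearMap.id := by
    rw [locCoact, ← LinearMap.comp_assoc (M.coact ∘ₗ _), LinearMap.lTensor_comp_map,
      LocalizedCoalgebra.counit_comp_proj, ← LinearMap.comp_assoc, h]
    calc _ = M.locProj e ∘ₗ (M.locIncl e ∘ₗ M.locProj e) ∘ₗ M.locIncl e := rfl
      _ = _ := by
        rw [LinearMap.comp_assoc, locProj_comp_locIncl he, LinearMap.comp_id,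
          locProj_comp_locIncl he]
  ext1 x
  apply (TensorProduct.rid K _).injective
  simpa using DFunLike.congr_fun h' x

/-- The right `eCe`-comodule `eM`. -/
def localize : RightComodule K (LocalizedCoalgebra e he) where
  carrier := LinearMap.range (act e M)
  coact := M.locCoact he
  coassoc := M.locCoact_coassoc he
  lTensor_counit_comp_coact := M.locCoact_counit he

variable {M} in
lemma lin_comp_act {N : RightComodule K C} (f : M ⟶ N) (e : WithConv (C →ₗ[K] K)) :
    Hom.lin f ∘ₗ act e M = act e N ∘ₗ Hom.lin f := by
  have hf : (Hom.lin f).rTensor C ∘ₗ M.coact = N.coact ∘ₗ Hom.lin f := f.2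
  have h : Hom.lin f ∘ₗ (TensorProduct.rid K _).toLinearMap ∘ₗ e.ofConv.lTensor _ =
      (TensorProduct.rid K _).toLinearMap ∘ₗ e.ofConv.lTensor _ ∘ₗ (Hom.lin f).rTensor C := by
    ext x y
    simp
  calc _ = (Hom.lin f ∘ₗ (TensorProduct.rid K _).toLinearMap ∘ₗ e.ofConv.lTensor _) ∘ₗ
        M.coact := rfl
    _ = (TensorProduct.rid K _).toLinearMap ∘ₗ e.ofConv.lTensor _ ∘ₗ
        ((Hom.lin f).rTensor C ∘ₗ M.coact) := by rw [h]; rfl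
    _ = _ := by rw [hf]; rfl

variable {M} in
/-- The restriction `eM → eN` of a comodule map `f : M → N`. -/
def localizeLin {N : RightComodule K C} (f : M ⟶ N) (e : WithConv (C →ₗ[K] K)) :
    LinearMap.range (act e M) →ₗ[K] LinearMap.range (act e N) :=
  (Hom.lin f).restrict (by
    rintro _ ⟨x, rfl⟩
    exact ⟨Hom.lin f x, (DFunLike.congr_fun (lin_comp_act f e) x).symm⟩)

variable {M} in
lemma localizeLin_comp_locProj {N : RightComodule K C} (f : M ⟶ N)
    (e : WithConv (C →ₗ[K] K)) :
    localizeLin f e ∘ₗ M.locProj e = N.locProj e ∘ₗ Hom.lin f := by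
  ext x
  exact DFunLike.congr_fun (lin_comp_act f e) x

variable {M} in
lemma localizeLin_mem {N : RightComodule K C} (f : M ⟶ N) :
    localizeLin f e ∈ homSubmodule (M.localize he) (N.localize he) := by
  have hf : (Hom.lin f).rTensor C ∘ₗ M.coact = N.coact ∘ₗ Hom.lin f := f.2
  set q := LocalizedCoalgebra.proj he
  change (localizeLin f e).rTensor _ ∘ₗ M.locCoact he = N.locCoact he ∘ₗ localizeLin f e
  calc _ = ((localizeLin f e).rTensor _ ∘ₗ TensorProduct.map (M.locProj e) q) ∘ₗ
        M.coact ∘ₗ M.locIncl e := rfl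
    _ = TensorProduct.map (N.locProj e) q ∘ₗ ((Hom.lin f).rTensor C ∘ₗ M.coact) ∘ₗ
        M.locIncl e := by
      rw [LinearMap.rTensor_comp_map, localizeLin_comp_locProj, ← LinearMap.map_comp_rTensor]
      rfl
    _ = _ := by rw [hf]; rfl

/-- The functor `T = e(-) : 𝓜^C ⥤ 𝓜^{eCe}`, `M ↦ eM`. This is the quotient functor of `𝓜^C`
by its localizing subcategory `𝓣_e` of all comodules `M` with `eM = 0`. -/
def localizeFunctor : RightComodule K C ⥤ RightComodule K (LocalizedCoalgebra e he) where
  obj M := M.localize he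
  map f := ⟨localizeLin f e, localizeLin_mem he f⟩

end RightComodule

/-- The idempotent `e` of `C^*` defines a perfect colocalization: the quotient functor
`T = e(-) : 𝓜^C ⥤ 𝓜^{eCe}` has a left adjoint (the colocalizing functor `H`), and this left
adjoint is exact. -/
def IsPerfectColocalizing {K C : Type u} [Field K] [AddCommGroup C] [Module K C]
    [Coalgebra K C] {e : WithConv (C →ₗ[K] K)} (he : IsIdempotentElem e) : Prop :=
  ∃ H : RightComodule K (LocalizedCoalgebra e he) ⥤ RightComodule K C,
    Nonempty (H ⊣ RightComodule.localizeFunctor he) ∧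
    ∀ ⦃X Y Z : RightComodule K (LocalizedCoalgebra e he)⦄ (f : X ⟶ Y) (g : Y ⟶ Z),
      RightComodule.IsShortExact f g → RightComodule.IsShortExact (H.map f) (H.map g)

/-! ### The path algebra of a finite quiver -/

/-- The underlying vector space of the path algebra: the free `K`-vector space on the set of all
(oriented) paths. -/
def PathAlgebra (K : Type u) (V : Type) [Field K] [Quiver.{0} V] : Type u :=
  (Σ i j : V, Quiver.Path i j) →₀ K

namespace PathAlgebra

variable {K : Type u} {V : Type} [Field K] [Quiver.{0} V]

instance : AddCommGroup (PathAlgebra K V) :=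
  inferInstanceAs (AddCommGroup ((Σ i j : V, Quiver.Path i j) →₀ K))

instance : Module K (PathAlgebra K V) :=
  inferInstanceAs (Module K ((Σ i j : V, Quiver.Path i j) →₀ K))

/-- The basis element of the path algebra given by a path. -/
def ofPath (p : Σ i j : V, Quiver.Path i j) : PathAlgebra K V :=
  Finsupp.single p 1

lemma hom_ext {N : Type*} [AddCommGroup N] [Module K N] {f g : PathAlgebra K V →ₗ[K] N}
    (h : ∀ p, f (ofPath p) = g (ofPath p)) : f = g :=
  Finsupp.lhom_ext' fun p => LinearMap.ext_ring (h p)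

open Classical in
/-- The product `p q` of two paths is the path "`q`, then `p`" if `q` ends where `p` starts, and
it is zero otherwise. -/
def pathMul (p q : Σ i j : V, Quiver.Path i j) : PathAlgebra K V :=
  if h : q.2.1 = p.1 then ofPath ⟨q.1, p.2.1, (q.2.2.cast rfl h).comp p.2.2⟩ else 0

lemma pathMul_comp {i j k : V} (q : Quiver.Path i j) (p : Quiver.Path j k) :
    pathMul (K := K) ⟨j, k, p⟩ ⟨i, j, q⟩ = ofPath ⟨i, k, q.comp p⟩ := by
  simp [pathMul]

lemma pathMul_of_ne {p q : Σ i j : V, Quiver.Path i j} (h : q.2.1 ≠ p.1) :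
    pathMul (K := K) p q = 0 := by
  simp [pathMul, h]

/-- The multiplication of the path algebra, as a bilinear map. -/
def mulHom : PathAlgebra K V →ₗ[K] PathAlgebra K V →ₗ[K] PathAlgebra K V :=
  Finsupp.linearCombination K fun p => Finsupp.linearCombination K fun q => pathMul p q

lemma mulHom_ofPath (p q : Σ i j : V, Quiver.Path i j) :
    mulHom (K := K) (ofPath p) (ofPath q) = pathMul p q := by
  have h := Finsupp.linearCombination_single K (v := fun p : (Σ i j : V, Quiver.Path i j) =>
    Finsupp.linearCombination K fun q => pathMul (K := K) p q) 1 p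
  have h' := Finsupp.linearCombination_single K (v := fun q : (Σ i j : V, Quiver.Path i j) =>
    pathMul (K := K) p q) 1 q
  rw [one_smul] at h h'
  exact (DFunLike.congr_fun h _).trans h'

lemma mulHom_assoc_ofPath (p q r : Σ i j : V, Quiver.Path i j) :
    mulHom (K := K) (mulHom (ofPath p) (ofPath q)) (ofPath r) =
      mulHom (ofPath p) (mulHom (ofPath q) (ofPath r)) := by
  rw [mulHom_ofPath, mulHom_ofPath]
  obtain ⟨p₁, p₂, p⟩ := p
  obtain ⟨q₁, q₂, q⟩ := q
  obtain ⟨r₁, r₂, r⟩ := r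
  by_cases h : q₂ = p₁ <;> by_cases h' : r₂ = q₁
  · subst h h'
    simp only [pathMul_comp, mulHom_ofPath, Quiver.Path.comp_assoc]
  · subst h
    rw [pathMul_comp, mulHom_ofPath, pathMul_of_ne h', pathMul_of_ne h', map_zero]
  · subst h'
    rw [pathMul_comp, mulHom_ofPath, pathMul_of_ne h, pathMul_of_ne h, LinearMap.map_zero₂]
  · rw [pathMul_of_ne h, pathMul_of_ne h', map_zero, map_zero, LinearMap.zero_apply]

lemma mulHom_assoc (a b c : PathAlgebra K V) :
    mulHom (mulHom a b) c = mulHom a (mulHom b c) := by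
  have hc (p q) : mulHom (mulHom (ofPath p) (ofPath q)) = mulHom (ofPath p) ∘ₗ
      mulHom (K := K) (V := V) (ofPath q) :=
    hom_ext fun r => mulHom_assoc_ofPath p q r
  have hb (p) : mulHom.flip c ∘ₗ mulHom (K := K) (V := V) (ofPath p) =
      mulHom (ofPath p) ∘ₗ mulHom.flip c :=
    hom_ext fun q => DFunLike.congr_fun (hc p q) c
  have ha : mulHom.flip c ∘ₗ mulHom.flip b =
      (mulHom (K := K) (V := V)).flip (mulHom b c) :=
    hom_ext fun p => DFunLike.congr_fun (hb p) b
  exact DFunLike.congr_fun ha a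

variable [Fintype V]

/-- The unit of the path algebra: the sum of all trivial paths. -/
def unit : PathAlgebra K V := ∑ i : V, ofPath ⟨i, i, Quiver.Path.nil⟩

lemma unit_mul (a : PathAlgebra K V) : mulHom unit a = a := by
  suffices h : mulHom (K := K) (V := V) unit = LinearMap.id from DFunLike.congr_fun h a
  refine hom_ext fun p => ?_
  obtain ⟨i, j, p⟩ := p
  rw [unit, map_sum, LinearMap.sum_apply, Finset.sum_eq_single j]
  · rw [mulHom_ofPath, pathMul_comp, Quiver.Path.comp_nil, LinearMap.id_apply]
  · intro k _ hk
    rw [mulHom_ofPath, pathMul_of_ne hk.symm]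
  · simp

lemma mul_unit (a : PathAlgebra K V) : mulHom a unit = a := by
  suffices h : (mulHom (K := K) (V := V)).flip unit = LinearMap.id from DFunLike.congr_fun h a
  refine hom_ext fun p => ?_
  obtain ⟨i, j, p⟩ := p
  rw [LinearMap.flip_apply, unit, map_sum, Finset.sum_eq_single i]
  · rw [mulHom_ofPath, pathMul_comp, Quiver.Path.nil_comp, LinearMap.id_apply]
  · intro k _ hk
    rw [mulHom_ofPath, pathMul_of_ne hk]
  · simp

instance : Ring (PathAlgebra K V) where
  __ := (inferInstance : AddCommGroup (PathAlgebra K V))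
  mul a b := mulHom a b
  one := unit
  left_distrib a b c := map_add (mulHom a) b c
  right_distrib a b c := LinearMap.map_add₂ mulHom a b c
  zero_mul a := LinearMap.map_zero₂ mulHom a
  mul_zero a := map_zero (mulHom a)
  mul_assoc := mulHom_assoc
  one_mul := unit_mul
  mul_one := mul_unit

instance : Algebra K (PathAlgebra K V) :=
  Algebra.ofModule (fun r a b => LinearMap.map_smul₂ mulHom r a b)
    (fun r a b => map_smul (mulHom a) r b)

end PathAlgebra

/-- The two vertices of the quiver `∘ ⇶ ∘`. -/
inductive KroneckerVertex : Type
  | source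
  | sink
  deriving DecidableEq

instance : Fintype KroneckerVertex where
  elems := {KroneckerVertex.source, KroneckerVertex.sink}
  complete x := by cases x <;> simp

/-- The arrows of the quiver `∘ ⇶ ∘`: three arrows from `source` to `sink`, and no others. -/
inductive KroneckerArrow : KroneckerVertex → KroneckerVertex → Type
  | arrow (n : Fin 3) : KroneckerArrow KroneckerVertex.source KroneckerVertex.sink

/-- The quiver `Q = (∘ ⇶ ∘)`. -/
instance : Quiver.{0} KroneckerVertex where
  Hom := KroneckerArrow

/-- The path algebra `KQ` of the quiver `Q = (∘ ⇶ ∘)`. -/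
abbrev KroneckerAlgebra (K : Type u) [Field K] : Type u :=
  PathAlgebra K KroneckerVertex

open scoped ModuleCat in
/-- The finite-dimensional right `KQ`-modules, that is, the finite-dimensional modules over the
opposite algebra of `KQ`. -/
def isFiniteDimensionalKroneckerModule (K : Type u) [Field K] :
    ObjectProperty (ModuleCat.{u} (KroneckerAlgebra K)ᵐᵒᵖ) :=
  fun M => FiniteDimensional K M

/-- The category `𝓜^f_{KQ}` of finite-dimensional right `KQ`-modules. -/
abbrev FinDimKroneckerModule (K : Type u) [Field K] : Type (u + 1) :=
  (isFiniteDimensionalKroneckerModule K).FullSubcategory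

/-! ### Wild comodule type -/

/-- An object `X` is indecomposable if it is non-zero and, whenever `X ≅ Y ⊕ Z`, one of `Y` and
`Z` is zero. -/
def IsIndecomposable {A : Type*} [Category A] [HasZeroMorphisms A] (X : A) : Prop :=
  ¬ IsZero X ∧ ∀ (Y Z : A) (b : BinaryBicone Y Z), Nonempty b.IsBilimit →
    Nonempty (X ≅ b.pt) → IsZero Y ∨ IsZero Z

/-- A `K`-coalgebra `C` is of wild comodule type if there is an exact and faithful `K`-linear
functor `F : 𝓜^f_{KQ} ⥤ 𝓜_f^C`, where `Q = (∘ ⇶ ∘)`, that respects isomorphism classes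
(`F X ≅ F Y` implies `X ≅ Y`) and carries indecomposable modules to indecomposable comodules. -/
def IsWildComoduleType (K C : Type u) [Field K] [AddCommGroup C] [Module K C]
    [Coalgebra K C] : Prop :=
  ∃ F : FinDimKroneckerModule K ⥤ RightComodule.FinDim K C,
    F.Additive ∧ F.Linear K ∧ F.Faithful ∧
    (∀ ⦃X Y Z : FinDimKroneckerModule K⦄ (f : X ⟶ Y) (g : Y ⟶ Z),
      Function.Injective f.hom → Function.Exact f.hom g.hom → Function.Surjective g.hom →
        RightComodule.IsShortExact (F.map f).hom (F.map g).hom) ∧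
    (∀ X Y : FinDimKroneckerModule K, Nonempty (F.obj X ≅ F.obj Y) → Nonempty (X ≅ Y)) ∧
    (∀ X : FinDimKroneckerModule K, IsIndecomposable X → IsIndecomposable (F.obj X))

end

/-! ### Slices of tensors and the action of the dual algebra -/

/-! Let $H$ be the exact left adjoint of $T$. Once $H$ is fully faithful and preserves finite
dimension, composing the functor $F$ that makes $eCe$ wild with $H$ gives one for $C$. Exactness and
linearity compose; faithfulness and reflection of isomorphism classes come from full faithfulness.
Indecomposability survives because a summand $Y$ of $HX$ with $TY = 0$ satisfies $\mathrm{Hom}(HX,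
Y) = \mathrm{Hom}(X, TY) = 0$, hence $Y = 0$ (`IsIndecomposable.map_leftAdjoint`).

Full faithfulness of $H$ means that the unit $N \to eHN$ is an isomorphism (`isIso_unit`). It is
injective because $N$ embeds into $eM$ for the cofree comodule $M = N \otimes C$
(`exists_injective_hom_localize`), and this embedding factors through the unit.

For surjectivity, comodules are viewed as left $C^*$-modules, whose $C^*$-stable subspaces are
kernels of comodule maps (`exists_hom_ker_eq`). A map out of $HN$ that kills the image of $N$ is
zero, so this image generates $HN$ over $C^*$ (`eq_top_of_stable`). Since $eC^*e$ acts on the image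
through $eCe$ (`act_comp_act_comp_toAmbient`), $eHN = eC^*eN$ is no larger than the image. The same
generation statement and local finiteness show that $HN$ is finite-dimensional when $N$ is. -/

/-- Functionals on the second factor detect zero in a tensor product of vector spaces. -/
lemma TensorProduct.eq_zero_of_forall_lTensor {K M C : Type*} [Field K] [AddCommGroup M]
    [Module K M] [AddCommGroup C] [Module K C] (t : M ⊗[K] C)
    (h : ∀ f : C →ₗ[K] K, TensorProduct.rid K M (f.lTensor M t) = 0) : t = 0 := by
  classical
  let b := Module.Basis.ofVectorSpace K C
  -- The coefficients of `t` along a basis of `C` are its slices by the coordinate functionals.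
  apply (TensorProduct.equivFinsuppOfBasisRight (M := M) b).injective
  ext i
  rw [TensorProduct.equivFinsuppOfBasisRight_apply, h, map_zero, Finsupp.zero_apply]

namespace RightComodule

section Act

variable {K C : Type u} [Field K] [AddCommGroup C] [Module K C] [Coalgebra K C]

lemma Hom.comm {M N : RightComodule K C} (f : M ⟶ N) :
    (Hom.lin f).rTensor C ∘ₗ M.coact = N.coact ∘ₗ Hom.lin f := f.2

lemma Hom.lin_comp {M N P : RightComodule K C} (f : M ⟶ N) (g : N ⟶ P) :
    Hom.lin (f ≫ g) = Hom.lin g ∘ₗ Hom.lin f := rfl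

lemma Hom.lin_zero (M N : RightComodule K C) : Hom.lin (0 : M ⟶ N) = 0 := rfl

/-- A morphism of comodules from a colinear map. -/
def homMk {M N : RightComodule K C} (f : M.carrier →ₗ[K] N.carrier)
    (h : f.rTensor C ∘ₗ M.coact = N.coact ∘ₗ f) : M ⟶ N := ⟨f, h⟩

/-- The action of the counit is trivial. -/
lemma act_counit (M : RightComodule K C) :
    act (WithConv.toConv Coalgebra.counit) M = LinearMap.id := by
  ext x
  have h := DFunLike.congr_fun M.lTensor_counit_comp_coact x
  simp only [LinearMap.comp_apply] at h
  simp [act, h]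

/-- `g.ofConv ∘ₗ dualLeft f` is the convolution product $gf$, so this is associativity of the left
action of $C^*$. -/
lemma act_comp_dualLeft (M : RightComodule K C) (f g : WithConv (C →ₗ[K] K)) :
    act (WithConv.toConv (g.ofConv ∘ₗ dualLeft f)) M = act g M ∘ₗ act f M := by
  conv_rhs => enter [1]; rw [act]
  rw [LinearMap.comp_assoc, LinearMap.comp_assoc, coact_comp_act, act, WithConv.ofConv_toConv,
    LinearMap.lTensor_comp]
  rfl

/-- Both sides are $\sum m_{(0)} f(m_{(1)}) \otimes m_{(2)}$: coassociativity with `f` applied to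
the middle factor. -/
lemma lTensor_dualRight_comp_coact (M : RightComodule K C) (f : WithConv (C →ₗ[K] K)) :
    (dualRight f).lTensor M.carrier ∘ₗ M.coact = (act f M).rTensor C ∘ₗ M.coact := by
  have h : ((TensorProduct.lid K C).toLinearMap ∘ₗ f.ofConv.rTensor C).lTensor M.carrier ∘ₗ
      (TensorProduct.assoc K M.carrier C C).toLinearMap =
      ((TensorProduct.rid K M.carrier).toLinearMap ∘ₗ f.ofConv.lTensor M.carrier).rTensor C := by
    ext x y z
    simp [TensorProduct.smul_tmul]
  calc _ = ((TensorProduct.lid K C).toLinearMap ∘ₗ f.ofConv.rTensor C).lTensor M.carrier ∘ₗ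
        (Coalgebra.comul (R := K) (A := C)).lTensor M.carrier ∘ₗ M.coact := by
        rw [← LinearMap.comp_assoc, ← LinearMap.lTensor_comp]; rfl
    _ = (((TensorProduct.lid K C).toLinearMap ∘ₗ f.ofConv.rTensor C).lTensor M.carrier ∘ₗ
        (TensorProduct.assoc K M.carrier C C).toLinearMap) ∘ₗ M.coact.rTensor C ∘ₗ M.coact := by
        rw [← M.coassoc]; rfl
    _ = _ := by
        rw [h, ← LinearMap.comp_assoc, ← LinearMap.rTensor_comp]; rfl

/-- Here the functional is the product $fg$. With `act_comp_dualLeft` this allows multiplication by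
$e$ on either side, as needed for $efe$. -/
lemma act_comp_dualRight (M : RightComodule K C) (f g : WithConv (C →ₗ[K] K)) :
    act (WithConv.toConv (g.ofConv ∘ₗ dualRight f)) M = act f M ∘ₗ act g M := by
  have h : (TensorProduct.rid K M.carrier).toLinearMap ∘ₗ g.ofConv.lTensor M.carrier ∘ₗ
      (act f M).rTensor C = act f M ∘ₗ (TensorProduct.rid K M.carrier).toLinearMap ∘ₗ
        g.ofConv.lTensor M.carrier := by
    ext x y
    simp
  calc _ = (TensorProduct.rid K M.carrier).toLinearMap ∘ₗ g.ofConv.lTensor M.carrier ∘ₗ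
        ((dualRight f).lTensor M.carrier ∘ₗ M.coact) := by
        rw [act, WithConv.ofConv_toConv, LinearMap.lTensor_comp]; rfl
    _ = ((TensorProduct.rid K M.carrier).toLinearMap ∘ₗ g.ofConv.lTensor M.carrier ∘ₗ
        (act f M).rTensor C) ∘ₗ M.coact := by rw [lTensor_dualRight_comp_coact]; rfl
    _ = _ := by rw [h]; rfl

/-! ### Local finiteness, quotient comodules and cofree comodules. -/

/-- Every finite-dimensional subspace of a comodule lies in a finite-dimensional subspace which
is stable under the dual algebra. -/
lemma exists_finite_stable (M : RightComodule K C) (S : Submodule K M.carrier)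
    [Module.Finite K S] : ∃ U : Submodule K M.carrier, Module.Finite K U ∧ S ≤ U ∧
      ∀ f : WithConv (C →ₗ[K] K), U ≤ U.comap (act f M) := by
  obtain ⟨s, hs⟩ := (Submodule.fg_def.mp (Module.Finite.iff_fg.mp ‹Module.Finite K S›))
  -- The coactions of finitely many generators lie in $M' \otimes C$ with $M'$ finite-dimensional,
  -- and then $M'$ contains $fx$ for every functional $f$ at once. The subspace sought is $C^*S$.
  obtain ⟨M', hfin, hM'⟩ := TensorProduct.exists_finite_submodule_left_of_setFinite
    (M.coact '' s) (hs.1.image _)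
  refine ⟨⨆ f : WithConv (C →ₗ[K] K), S.map (act f M), ?_, ?_, ?_⟩
  · refine Submodule.finiteDimensional_of_le (S₂ := M') (iSup_le fun f => ?_)
    rw [Submodule.map_le_iff_le_comap, ← hs.2, Submodule.span_le]
    intro x hx
    obtain ⟨t, ht⟩ := hM' ⟨x, hx, rfl⟩
    have h : (TensorProduct.rid K M.carrier).toLinearMap ∘ₗ f.ofConv.lTensor M.carrier ∘ₗ
        M'.subtype.rTensor C = M'.subtype ∘ₗ (TensorProduct.rid K M').toLinearMap ∘ₗ
          f.ofConv.lTensor M' := by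
      ext x y
      simp
    have h2 := DFunLike.congr_fun h t
    simp only [LinearMap.comp_apply] at h2
    rw [ht] at h2
    change act f M x ∈ M'
    rw [act, LinearMap.comp_apply, LinearMap.comp_apply, h2]
    exact Subtype.property _
  · refine le_trans ?_ (le_iSup _ (WithConv.toConv Coalgebra.counit))
    rw [act_counit, Submodule.map_id]
  · intro f
    refine iSup_le fun g => ?_
    rw [← Submodule.map_le_iff_le_comap, ← Submodule.map_comp, ← act_comp_dualLeft]
    exact le_iSup (fun g => S.map (act g M)) _

/-- The quotient of a comodule by a linear map `q` with linear section `j`, whose kernel is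
a subcomodule. -/
def quot (M : RightComodule K C) {Q : Type u} [AddCommGroup Q] [Module K Q]
    (q : M.carrier →ₗ[K] Q) (j : Q →ₗ[K] M.carrier) (hqj : q ∘ₗ j = LinearMap.id)
    (h : q.rTensor C ∘ₗ M.coact ∘ₗ j ∘ₗ q = q.rTensor C ∘ₗ M.coact) : RightComodule K C where
  carrier := Q
  coact := q.rTensor C ∘ₗ M.coact ∘ₗ j
  coassoc := by
    have h1 : (q.rTensor C ∘ₗ M.coact ∘ₗ j).rTensor C ∘ₗ q.rTensor C =
        (q.rTensor C).rTensor C ∘ₗ M.coact.rTensor C := by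
      rw [← LinearMap.rTensor_comp, ← LinearMap.rTensor_comp, ← h]
      rfl
    have h2 : (TensorProduct.assoc K Q C C).toLinearMap ∘ₗ (q.rTensor C).rTensor C =
        q.rTensor (C ⊗[K] C) ∘ₗ (TensorProduct.assoc K M.carrier C C).toLinearMap := by
      ext x y z
      simp
    calc _ = (TensorProduct.assoc K Q C C).toLinearMap ∘ₗ
          ((q.rTensor C ∘ₗ M.coact ∘ₗ j).rTensor C ∘ₗ q.rTensor C) ∘ₗ M.coact ∘ₗ j := rfl
      _ = ((TensorProduct.assoc K Q C C).toLinearMap ∘ₗ (q.rTensor C).rTensor C) ∘ₗ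
          M.coact.rTensor C ∘ₗ M.coact ∘ₗ j := by rw [h1]; rfl
      _ = q.rTensor (C ⊗[K] C) ∘ₗ ((TensorProduct.assoc K M.carrier C C).toLinearMap ∘ₗ
          M.coact.rTensor C ∘ₗ M.coact) ∘ₗ j := by rw [h2]; rfl
      _ = (q.rTensor (C ⊗[K] C) ∘ₗ Coalgebra.comul.lTensor M.carrier) ∘ₗ M.coact ∘ₗ j := by
          rw [M.coassoc]; rfl
      _ = _ := by rw [LinearMap.rTensor_comp_lTensor, ← LinearMap.lTensor_comp_rTensor]; rfl
  lTensor_counit_comp_coact := by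
    calc _ = (Coalgebra.counit.lTensor Q ∘ₗ q.rTensor C) ∘ₗ M.coact ∘ₗ j := rfl
      _ = q.rTensor K ∘ₗ (Coalgebra.counit.lTensor M.carrier ∘ₗ M.coact) ∘ₗ j := by
          rw [LinearMap.lTensor_comp_rTensor, ← LinearMap.rTensor_comp_lTensor]; rfl
      _ = _ := by
          rw [M.lTensor_counit_comp_coact]
          ext x
          have := DFunLike.congr_fun hqj x
          simp only [LinearMap.comp_apply, LinearMap.id_apply] at this
          simp [this]

/-- A subspace stable under the dual algebra is the kernel of a morphism of comodules. -/
lemma exists_hom_ker_eq (M : RightComodule K C) (U : Submodule K M.carrier)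
    (hU : ∀ f : WithConv (C →ₗ[K] K), U ≤ U.comap (act f M)) :
    ∃ (Q : RightComodule K C) (π : M ⟶ Q), LinearMap.ker (Hom.lin π) = U := by
  obtain ⟨j, hj⟩ := U.mkQ.exists_rightInverse_of_surjective (Submodule.range_mkQ U)
  -- The slice of this tensor by `f` is the class of $fx$ modulo `U`, which vanishes by stability.
  have hker (x) (hx : x ∈ U) : U.mkQ.rTensor C (M.coact x) = 0 := by
    refine TensorProduct.eq_zero_of_forall_lTensor _ fun f => ?_
    have h : (TensorProduct.rid K (M.carrier ⧸ U)).toLinearMap ∘ₗ f.lTensor _ ∘ₗ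
        U.mkQ.rTensor C = U.mkQ ∘ₗ (TensorProduct.rid K M.carrier).toLinearMap ∘ₗ
          f.lTensor _ := by
      ext x y
      simp
    refine (DFunLike.congr_fun h (M.coact x)).trans ?_
    exact (Submodule.Quotient.mk_eq_zero U).mpr (hU (WithConv.toConv f) hx)
  have h : U.mkQ.rTensor C ∘ₗ M.coact ∘ₗ j ∘ₗ U.mkQ = U.mkQ.rTensor C ∘ₗ M.coact := by
    ext x
    have hx : j (U.mkQ x) - x ∈ U := by
      rw [← Submodule.Quotient.mk_eq_zero U, Submodule.Quotient.mk_sub, sub_eq_zero]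
      exact DFunLike.congr_fun hj (U.mkQ x)
    have := hker _ hx
    rwa [map_sub, map_sub, sub_eq_zero] at this
  exact ⟨M.quot U.mkQ j hj h, homMk U.mkQ h.symm, Submodule.ker_mkQ U⟩

/-- The cofree comodule `V ⊗ C`. -/
def cofree (V C : Type u) [AddCommGroup V] [Module K V] [AddCommGroup C] [Module K C]
    [Coalgebra K C] : RightComodule K C where
  carrier := V ⊗[K] C
  coact := (TensorProduct.assoc K V C C).symm.toLinearMap ∘ₗ Coalgebra.comul.lTensor V
  coassoc := by
    refine TensorProduct.ext' fun v c => ?_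
    have h := DFunLike.congr_fun (Coalgebra.coassoc (R := K) (A := C)) c
    simp only [LinearMap.comp_apply, LinearEquiv.coe_coe, LinearMap.lTensor_tmul] at h ⊢
    have h1 (t : C ⊗[K] C) : (TensorProduct.assoc K (V ⊗[K] C) C C)
        (((TensorProduct.assoc K V C C).symm.toLinearMap ∘ₗ
          Coalgebra.comul.lTensor V).rTensor C ((TensorProduct.assoc K V C C).symm
            (v ⊗ₜ t))) = (TensorProduct.assoc K V C (C ⊗[K] C)).symm
              (v ⊗ₜ (TensorProduct.assoc K C C C (Coalgebra.comul.rTensor C t))) := by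
      induction t with
      | zero => simp
      | add x y hx hy => simp only [TensorProduct.tmul_add, map_add, hx, hy]
      | tmul x y =>
        simp only [TensorProduct.assoc_symm_tmul, LinearMap.rTensor_tmul, LinearMap.comp_apply,
          LinearEquiv.coe_coe, LinearMap.lTensor_tmul]
        generalize (Coalgebra.comul (R := K) x) = s
        induction s with
        | zero => simp
        | add x y hx hy => simp only [TensorProduct.tmul_add, TensorProduct.add_tmul, map_add,
            hx, hy]
        | tmul a b => simp
    have h2 (t : C ⊗[K] C) : (Coalgebra.comul (R := K)).lTensor (V ⊗[K] C)
        ((TensorProduct.assoc K V C C).symm (v ⊗ₜ t)) =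
        (TensorProduct.assoc K V C (C ⊗[K] C)).symm
              (v ⊗ₜ (Coalgebra.comul.lTensor C t)) := by
      induction t with
      | zero => simp
      | add x y hx hy => simp only [TensorProduct.tmul_add, map_add, hx, hy]
      | tmul x y => simp
    rw [h1, h2, h]
  lTensor_counit_comp_coact := by
    refine TensorProduct.ext' fun v c => ?_
    have h := DFunLike.congr_fun (Coalgebra.lTensor_counit_comp_comul (R := K) (A := C)) c
    simp only [LinearMap.comp_apply, LinearEquiv.coe_coe, LinearMap.lTensor_tmul] at h ⊢
    have h1 (t : C ⊗[K] C) : (Coalgebra.counit (R := K)).lTensor (V ⊗[K] C)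
        ((TensorProduct.assoc K V C C).symm (v ⊗ₜ t)) =
        (TensorProduct.assoc K V C K).symm (v ⊗ₜ (Coalgebra.counit.lTensor C t)) := by
      induction t with
      | zero => simp
      | add x y hx hy => simp only [TensorProduct.tmul_add, map_add, hx, hy]
      | tmul x y => simp
    rw [h1, h]
    simp

end Act

end RightComodule

/-! ### Morphisms from an $eCe$-comodule into $eM$. -/

namespace RightComodule

section Localize

variable {K C : Type u} [Field K] [AddCommGroup C] [Module K C] [Coalgebra K C]
  {e : WithConv (C →ₗ[K] K)} (he : IsIdempotentElem e)

instance localizeFunctor_additive :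
    (localizeFunctor he).Additive where
  map_add {_ _ _ _} := rfl

instance localizeFunctor_linear :
    (localizeFunctor he).Linear K where
  map_smul _ _ := rfl

/-- The linear map `N → M` underlying a morphism `N ⟶ eM`. -/
def toAmbient {N : RightComodule K (LocalizedCoalgebra e he)} {M : RightComodule K C}
    (g : N ⟶ (localizeFunctor he).obj M) : N.carrier →ₗ[K] M.carrier :=
  M.locIncl e ∘ₗ Hom.lin g

lemma toAmbient_comp_map {N : RightComodule K (LocalizedCoalgebra e he)}
    {M M' : RightComodule K C} (g : N ⟶ (localizeFunctor he).obj M) (f : M ⟶ M') :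
    toAmbient he (g ≫ (localizeFunctor he).map f) = Hom.lin f ∘ₗ toAmbient he g := rfl

lemma toAmbient_injective {N : RightComodule K (LocalizedCoalgebra e he)}
    {M : RightComodule K C} {g g' : N ⟶ (localizeFunctor he).obj M}
    (h : toAmbient he g = toAmbient he g') : g = g' := by
  refine Hom.lin_injective (LinearMap.ext fun x => ?_)
  exact Subtype.val_injective (DFunLike.congr_fun h x)

/-- For `x` in the image of `N ⟶ eM`, the vector `e f x` is again in the image. -/
lemma act_comp_act_comp_toAmbient {N : RightComodule K (LocalizedCoalgebra e he)}
    {M : RightComodule K C} (g : N ⟶ (localizeFunctor he).obj M) (f : WithConv (C →ₗ[K] K)) :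
    act e M ∘ₗ act f M ∘ₗ toAmbient he g = toAmbient he g ∘ₗ
      act (WithConv.toConv (f.ofConv ∘ₗ LocalizedCoalgebra.incl he)) N := by
  set q := LocalizedCoalgebra.proj he
  set i := LocalizedCoalgebra.incl he
  have hg : (Hom.lin g).rTensor _ ∘ₗ N.coact = M.locCoact he ∘ₗ Hom.lin g := g.2
  have h1 : M.locIncl e ∘ₗ (TensorProduct.rid K _).toLinearMap ∘ₗ
      (f.ofConv ∘ₗ i).lTensor _ ∘ₗ M.locCoact he = act e M ∘ₗ act f M ∘ₗ M.locIncl e := by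
    have h2 : M.locIncl e ∘ₗ (TensorProduct.rid K _).toLinearMap ∘ₗ
        (f.ofConv ∘ₗ i).lTensor _ ∘ₗ TensorProduct.map (M.locProj e) q =
        act e M ∘ₗ (TensorProduct.rid K M.carrier).toLinearMap ∘ₗ
          (f.ofConv ∘ₗ dualSandwich e).lTensor M.carrier := by
      ext x y
      have hx := DFunLike.congr_fun (M.locIncl_comp_locProj (e := e)) x
      have hy := DFunLike.congr_fun (LocalizedCoalgebra.incl_comp_proj he) y
      simp only [LinearMap.comp_apply] at hx hy
      simp [q, i, hx, hy]
    -- The functional `f.ofConv ∘ₗ dualSandwich e` is the product $efe$, so it acts as $e$, $f$, $e$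
    -- in succession; on $eM$ the innermost $e$ is the identity.
    have h3 := act_comp_dualLeft M e (WithConv.toConv (f.ofConv ∘ₗ dualRight e))
    rw [act_comp_dualRight] at h3
    have h4 : act e M ∘ₗ M.locIncl e = M.locIncl e := by
      ext ⟨_, y, rfl⟩
      exact DFunLike.congr_fun (M.act_comp_act he) y
    calc _ = (M.locIncl e ∘ₗ (TensorProduct.rid K _).toLinearMap ∘ₗ
        (f.ofConv ∘ₗ i).lTensor _ ∘ₗ TensorProduct.map (M.locProj e) q) ∘ₗ
          M.coact ∘ₗ M.locIncl e := rfl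
      _ = act e M ∘ₗ act (WithConv.toConv ((WithConv.toConv (f.ofConv ∘ₗ dualRight e)).ofConv ∘ₗ
          dualLeft e)) M ∘ₗ M.locIncl e := by rw [h2]; rfl
      _ = (act e M ∘ₗ act e M) ∘ₗ act f M ∘ₗ act e M ∘ₗ M.locIncl e := by rw [h3]; rfl
      _ = _ := by rw [M.act_comp_act he, h4]
  have h5 : Hom.lin g ∘ₗ (TensorProduct.rid K N.carrier).toLinearMap ∘ₗ
      (f.ofConv ∘ₗ i).lTensor N.carrier = (TensorProduct.rid K _).toLinearMap ∘ₗ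
      (f.ofConv ∘ₗ i).lTensor _ ∘ₗ (Hom.lin g).rTensor _ := by
    ext x y
    simp
  ext x
  refine (DFunLike.congr_fun h1 (Hom.lin g x)).symm.trans ?_
  have h6 := (DFunLike.congr_fun h5 (N.coact x)).symm
  have h7 := DFunLike.congr_fun hg x
  refine congrArg (M.locIncl e) (Eq.trans ?_ h6)
  exact congrArg (fun t => TensorProduct.rid K _ ((f.ofConv ∘ₗ i).lTensor _ t)) h7.symm

lemma dualLeft_comp_incl : dualLeft e ∘ₗ LocalizedCoalgebra.incl he =
    LocalizedCoalgebra.incl he := by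
  ext ⟨_, y, rfl⟩
  have h : dualLeft e ∘ₗ dualSandwich e = dualSandwich e := by
    rw [dualSandwich, ← LinearMap.comp_assoc, dualLeft_comp_dualRight, LinearMap.comp_assoc,
      dualLeft_comp_dualLeft he]
  exact DFunLike.congr_fun h y

lemma dualRight_comp_incl : dualRight e ∘ₗ LocalizedCoalgebra.incl he =
    LocalizedCoalgebra.incl he := by
  ext ⟨_, y, rfl⟩
  have h : dualRight e ∘ₗ dualSandwich e = dualSandwich e := by
    rw [dualSandwich, ← LinearMap.comp_assoc, dualRight_comp_dualRight he]
  exact DFunLike.congr_fun h y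

lemma rTensor_dualLeft_comp_comul (f : WithConv (C →ₗ[K] K)) :
    (dualLeft f).rTensor C ∘ₗ Coalgebra.comul = (dualRight f).lTensor C ∘ₗ Coalgebra.comul :=
  (lTensor_dualRight_comp_coact (regular K C) f).symm

/-- For $x \in eCe$ this reads $\sum x_{(1)} \otimes ex_{(2)}e = \sum ex_{(1)}e \otimes ex_{(2)}e$.
Acting by $e$ on the inner side of the first leg can be moved to the second leg, where the
projection absorbs it; acting on the outer side is harmless because $xe = x$. -/
lemma lTensor_proj_comp_comul_comp_incl :
    (LocalizedCoalgebra.proj he).lTensor C ∘ₗ Coalgebra.comul ∘ₗ LocalizedCoalgebra.incl he =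
      (LocalizedCoalgebra.incl he).rTensor (LocalizedCoalgebra e he) ∘ₗ Coalgebra.comul := by
  symm
  set q := LocalizedCoalgebra.proj he
  set i := LocalizedCoalgebra.incl he
  calc _ = (i.rTensor (LocalizedCoalgebra e he) ∘ₗ TensorProduct.map q q) ∘ₗ
        Coalgebra.comul ∘ₗ i := rfl
    _ = (q.lTensor C ∘ₗ (dualRight e).rTensor C) ∘ₗ (dualLeft e).rTensor C ∘ₗ
        Coalgebra.comul ∘ₗ i := by
      rw [LinearMap.rTensor_comp_map, LocalizedCoalgebra.incl_comp_proj,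
        LinearMap.lTensor_comp_rTensor, dualSandwich, ← LinearMap.map_comp_rTensor]
      rfl
    _ = q.lTensor C ∘ₗ (dualRight e).rTensor C ∘ₗ ((dualLeft e).rTensor C ∘ₗ
        Coalgebra.comul) ∘ₗ i := rfl
    _ = (q.lTensor C ∘ₗ (dualRight e).rTensor C ∘ₗ (dualRight e).lTensor C) ∘ₗ
        Coalgebra.comul ∘ₗ i := by rw [rTensor_dualLeft_comp_comul]; rfl
    _ = q.lTensor C ∘ₗ ((dualRight e).rTensor C ∘ₗ Coalgebra.comul) ∘ₗ i := by
      rw [LinearMap.rTensor_comp_lTensor, LinearMap.lTensor_comp_map,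
        LocalizedCoalgebra.proj_comp_dualRight, ← LinearMap.lTensor_comp_rTensor]
      rfl
    _ = _ := by
      rw [← comul_comp_dualRight, LinearMap.comp_assoc, dualRight_comp_incl]

lemma act_cofree (V : Type u) [AddCommGroup V] [Module K V] (f : WithConv (C →ₗ[K] K))
    (x : V ⊗[K] C) : act f (cofree V C) x = (dualLeft f).lTensor V x := by
  suffices h : act f (cofree V C) = (dualLeft f).lTensor V from DFunLike.congr_fun h x
  refine TensorProduct.ext' fun v c => ?_
  change TensorProduct.rid K _ (f.ofConv.lTensor _ ((TensorProduct.assoc K V C C).symm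
    (v ⊗ₜ[K] Coalgebra.comul (R := K) c))) = v ⊗ₜ[K] (TensorProduct.rid K C (f.ofConv.lTensor C
      (Coalgebra.comul (R := K) c)))
  generalize (Coalgebra.comul (R := K) c) = t
  induction t with
  | zero => simp
  | add x y hx hy => simp only [TensorProduct.tmul_add, map_add, hx, hy]
  | tmul x y => simp

/-- The embedding `N → N ⊗ eCe → N ⊗ C`. -/
def toCofree (N : RightComodule K (LocalizedCoalgebra e he)) :
    N.carrier →ₗ[K] N.carrier ⊗[K] C :=
  (LocalizedCoalgebra.incl he).lTensor N.carrier ∘ₗ N.coact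

lemma toCofree_injective (N : RightComodule K (LocalizedCoalgebra e he)) :
    Function.Injective (toCofree he N) := by
  have h1 : (LocalizedCoalgebra.proj he).lTensor N.carrier ∘ₗ
      (LocalizedCoalgebra.incl he).lTensor N.carrier = LinearMap.id := by
    rw [← LinearMap.lTensor_comp, LocalizedCoalgebra.proj_comp_incl, LinearMap.lTensor_id]
  refine Function.LeftInverse.injective
    (g := fun y => TensorProduct.rid K N.carrier (Coalgebra.counit.lTensor N.carrier
      ((LocalizedCoalgebra.proj he).lTensor N.carrier y))) fun x => ?_
  have h2 := DFunLike.congr_fun h1 (N.coact x)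
  have h3 := DFunLike.congr_fun N.lTensor_counit_comp_coact x
  simp only [LinearMap.comp_apply, LinearMap.id_apply] at h2 h3
  simp [toCofree, h2, h3]

/-- This is the colinearity of $N \to e(N \otimes C)$. Coassociativity of `N` reduces it to
`lTensor_proj_comp_comul_comp_incl` on the coalgebra factors. -/
lemma lTensor_proj_comp_coact_comp_toCofree (N : RightComodule K (LocalizedCoalgebra e he)) :
    (LocalizedCoalgebra.proj he).lTensor (N.carrier ⊗[K] C) ∘ₗ
      ((TensorProduct.assoc K N.carrier C C).symm.toLinearMap ∘ₗ
        Coalgebra.comul.lTensor N.carrier) ∘ₗ toCofree he N =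
      (toCofree he N).rTensor (LocalizedCoalgebra e he) ∘ₗ N.coact := by
  set q := LocalizedCoalgebra.proj he
  set i := LocalizedCoalgebra.incl he
  set D := LocalizedCoalgebra e he
  have h1 : q.lTensor (N.carrier ⊗[K] C) ∘ₗ
      (TensorProduct.assoc K N.carrier C C).symm.toLinearMap =
      (TensorProduct.assoc K N.carrier C D).symm.toLinearMap ∘ₗ
        (q.lTensor C).lTensor N.carrier := by
    ext x y z
    simp
  have h2 : (TensorProduct.assoc K N.carrier C D).symm.toLinearMap ∘ₗ
      (i.rTensor D).lTensor N.carrier ∘ₗ (TensorProduct.assoc K N.carrier D D).toLinearMap =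
      (i.lTensor N.carrier).rTensor D := by
    ext x y z
    simp
  calc _ = (q.lTensor (N.carrier ⊗[K] C) ∘ₗ
        (TensorProduct.assoc K N.carrier C C).symm.toLinearMap) ∘ₗ
        (Coalgebra.comul.lTensor N.carrier ∘ₗ i.lTensor N.carrier) ∘ₗ N.coact := rfl
    _ = (TensorProduct.assoc K N.carrier C D).symm.toLinearMap ∘ₗ
        (q.lTensor C ∘ₗ Coalgebra.comul ∘ₗ i).lTensor N.carrier ∘ₗ N.coact := by
      rw [h1, LinearMap.lTensor_comp, LinearMap.lTensor_comp]
      rfl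
    _ = (TensorProduct.assoc K N.carrier C D).symm.toLinearMap ∘ₗ
        (i.rTensor D).lTensor N.carrier ∘ₗ
          (Coalgebra.comul.lTensor N.carrier ∘ₗ N.coact) := by
      rw [lTensor_proj_comp_comul_comp_incl, LinearMap.lTensor_comp]
      rfl
    _ = ((TensorProduct.assoc K N.carrier C D).symm.toLinearMap ∘ₗ
        (i.rTensor D).lTensor N.carrier ∘ₗ (TensorProduct.assoc K N.carrier D D).toLinearMap) ∘ₗ
          N.coact.rTensor D ∘ₗ N.coact := by
      rw [← N.coassoc]
      rfl
    _ = _ := by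
      rw [h2, ← LinearMap.comp_assoc, ← LinearMap.rTensor_comp]
      rfl

/-- Every `eCe`-comodule `N` embeds into `eM` for a `C`-comodule `M`, namely for the cofree
comodule `N ⊗ C`. -/
lemma exists_injective_hom_localize (N : RightComodule K (LocalizedCoalgebra e he)) :
    ∃ (M : RightComodule K C) (g : N ⟶ (localizeFunctor he).obj M),
      Function.Injective (Hom.lin g) := by
  let M : RightComodule K C := cofree N.carrier C
  let φ : N.carrier →ₗ[K] M.carrier := toCofree he N
  have hφ : (LocalizedCoalgebra.proj he).lTensor M.carrier ∘ₗ M.coact ∘ₗ φ =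
      φ.rTensor _ ∘ₗ N.coact := lTensor_proj_comp_coact_comp_toCofree he N
  have hmor : (M.locProj e ∘ₗ φ).rTensor _ ∘ₗ N.coact =
      M.locCoact he ∘ₗ M.locProj e ∘ₗ φ := by
    rw [← LinearMap.comp_assoc _ _ (M.locCoact he), locCoact_comp_locProj,
      LinearMap.rTensor_comp, LinearMap.comp_assoc, ← hφ, ← LinearMap.comp_assoc,
      LinearMap.rTensor_comp_lTensor]
    rfl
  refine ⟨M, homMk (N := M.localize he) (M.locProj e ∘ₗ φ) hmor, fun x y hxy => ?_⟩
  -- The image of `φ` lies in $N \otimes eCe$, which $e$ fixes, so projecting to $eM$ loses nothing.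
  have hact (x : N.carrier) : act e M (φ x) = φ x := by
    refine (act_cofree N.carrier e (toCofree he N x)).trans ?_
    change _ = toCofree he N x
    rw [toCofree, LinearMap.comp_apply, ← LinearMap.comp_apply, ← LinearMap.lTensor_comp,
      dualLeft_comp_incl]
  apply toCofree_injective he N
  change φ x = φ y
  rw [← hact x, ← hact y]
  exact congrArg Subtype.val hxy

/-! ### Comodules generated by the image of $N \to eM$. -/

section Universal

variable {N : RightComodule K (LocalizedCoalgebra e he)} {M : RightComodule K C}
  (g : N ⟶ (localizeFunctor he).obj M)

/-- If morphisms from `M` are determined by their composites with `g : N ⟶ eM`, then `M` is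
generated by the image of `g`. -/
lemma eq_top_of_stable
    (hg : ∀ ⦃Q : RightComodule K C⦄ (f : M ⟶ Q), g ≫ (localizeFunctor he).map f = 0 → f = 0)
    (U : Submodule K M.carrier) (hU : ∀ f : WithConv (C →ₗ[K] K), U ≤ U.comap (act f M))
    (h : LinearMap.range (toAmbient he g) ≤ U) : U = ⊤ := by
  obtain ⟨Q, π, hπ⟩ := M.exists_hom_ker_eq U hU
  have : π = 0 := by
    refine hg π (toAmbient_injective he ?_)
    rw [toAmbient_comp_map]
    ext x
    have hx : toAmbient he g x ∈ LinearMap.ker (Hom.lin π) := hπ ▸ h ⟨x, rfl⟩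
    exact hx
  rw [← hπ, this, Hom.lin_zero, LinearMap.ker_zero]

/-- A finite-dimensional stable subspace containing the image of `N` exists by local finiteness, and
by generation it is all of `M`. -/
lemma finite_of_universal
    (hg : ∀ ⦃Q : RightComodule K C⦄ (f : M ⟶ Q), g ≫ (localizeFunctor he).map f = 0 → f = 0)
    [FiniteDimensional K N.carrier] : FiniteDimensional K M.carrier := by
  obtain ⟨U, hfin, hle, hU⟩ := M.exists_finite_stable (LinearMap.range (toAmbient he g))
  rw [eq_top_of_stable he g hg U hU hle] at hfin
  exact Module.finite_def.mpr (Module.Finite.iff_fg.mp hfin)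

lemma surjective_of_universal
    (hg : ∀ ⦃Q : RightComodule K C⦄ (f : M ⟶ Q), g ≫ (localizeFunctor he).map f = 0 → f = 0) :
    Function.Surjective (Hom.lin g) := by
  -- `U` consists of the $x$ with $efx$ in the image of `N` for all $f \in C^*$. Quantifying over
  -- all $f$ makes it stable.
  let U : Submodule K M.carrier := ⨅ f : WithConv (C →ₗ[K] K),
    (LinearMap.range (toAmbient he g)).comap (act e M ∘ₗ act f M)
  have hU : U = ⊤ := by
    refine eq_top_of_stable he g hg U (fun f => ?_) ?_
    · intro x hx
      rw [Submodule.mem_comap, Submodule.mem_iInf]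
      intro f'
      have := (Submodule.mem_iInf _).mp hx (WithConv.toConv (f'.ofConv ∘ₗ dualLeft f))
      rwa [act_comp_dualLeft] at this
    · refine le_iInf fun f => ?_
      rintro _ ⟨x, rfl⟩
      exact ⟨_, (DFunLike.congr_fun (act_comp_act_comp_toAmbient he g f) x).symm⟩
  rintro ⟨_, x, rfl⟩
  have hx : x ∈ U := hU ▸ Submodule.mem_top
  -- Taking $f = \varepsilon$ leaves the statement that $ex$ itself is in the image.
  have := (Submodule.mem_iInf _).mp hx (WithConv.toConv Coalgebra.counit)
  rw [act_counit] at this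
  obtain ⟨y, hy⟩ := this
  exact ⟨y, Subtype.ext hy⟩

end Universal

/-- The inverse of a bijective morphism is a morphism. -/
lemma isIso_of_bijective {M N : RightComodule K C} (f : M ⟶ N)
    (hf : Function.Bijective (Hom.lin f)) : IsIso f := by
  let E := LinearEquiv.ofBijective (Hom.lin f) hf
  have h1 : E.symm.toLinearMap ∘ₗ Hom.lin f = LinearMap.id := by
    ext x
    exact E.symm_apply_apply x
  have h2 : Hom.lin f ∘ₗ E.symm.toLinearMap = LinearMap.id := by
    ext x
    exact E.apply_symm_apply x
  have h : E.symm.toLinearMap.rTensor C ∘ₗ N.coact = M.coact ∘ₗ E.symm.toLinearMap := by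
    calc _ = E.symm.toLinearMap.rTensor C ∘ₗ (N.coact ∘ₗ Hom.lin f) ∘ₗ E.symm.toLinearMap := by
          rw [LinearMap.comp_assoc, h2, LinearMap.comp_id]
      _ = (E.symm.toLinearMap.rTensor C ∘ₗ (Hom.lin f).rTensor C) ∘ₗ M.coact ∘ₗ
          E.symm.toLinearMap := by rw [← Hom.comm]; rfl
      _ = _ := by rw [← LinearMap.rTensor_comp, h1, LinearMap.rTensor_id, LinearMap.id_comp]
  exact ⟨homMk E.symm.toLinearMap h, Hom.lin_injective h1, Hom.lin_injective h2⟩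

/-! ### The unit of the adjunction is an isomorphism. -/

section Adjunction

variable {he} {H : RightComodule K (LocalizedCoalgebra e he) ⥤ RightComodule K C}

lemma eq_zero_of_unit_comp_map_eq_zero (adj : H ⊣ localizeFunctor he)
    (N : RightComodule K (LocalizedCoalgebra e he))
    ⦃Q : RightComodule K C⦄ (f : H.obj N ⟶ Q)
    (h : adj.unit.app N ≫ (localizeFunctor he).map f = 0) : f = 0 := by
  apply (adj.homEquiv N Q).injective
  rw [adj.homEquiv_unit, adj.homEquiv_unit]
  refine h.trans ?_
  rw [Functor.map_zero, comp_zero]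

lemma finiteDimensional_obj (adj : H ⊣ localizeFunctor he)
    (N : RightComodule K (LocalizedCoalgebra e he))
    (hN : FiniteDimensional K N.carrier) : FiniteDimensional K (H.obj N).carrier :=
  finite_of_universal (N := N) he (adj.unit.app N) (eq_zero_of_unit_comp_map_eq_zero adj N)

lemma isIso_unit (adj : H ⊣ localizeFunctor he) : IsIso adj.unit := by
  rw [NatTrans.isIso_iff_isIso_app]
  intro N
  refine isIso_of_bijective _ ⟨?_, surjective_of_universal he (adj.unit.app N)
    (eq_zero_of_unit_comp_map_eq_zero adj N)⟩
  -- Every map $N \to eM$ factors through the unit, so one injective such map forces the unit to be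
  -- injective.
  obtain ⟨M, g, hg⟩ := exists_injective_hom_localize he N
  have h : adj.unit.app N ≫ (localizeFunctor he).map ((adj.homEquiv N M).symm g) = g :=
    (adj.homEquiv_unit _ _ _).symm.trans (Equiv.apply_symm_apply _ _)
  rw [← h, Hom.lin_comp, LinearMap.coe_comp] at hg
  exact hg.of_comp

end Adjunction

end Localize

end RightComodule

/-! ### Fully faithful left adjoints -/

section LeftAdjoint

variable {A B : Type*} [Category A] [Category B] [Preadditive A] [Preadditive B]
  {H : A ⥤ B} {T : B ⥤ A}

lemma CategoryTheory.Adjunction.linear_leftAdjoint (R : Type*) [Semiring R] [Linear R A]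
    [Linear R B] (adj : H ⊣ T) [T.Additive] [T.Linear R] : H.Linear R where
  map_smul {X Y} f r := by
    apply (adj.homEquiv _ _).injective
    rw [adj.homEquiv_unit, adj.homEquiv_unit, T.map_smul, Linear.comp_smul]
    rw [adj.unit_naturality, adj.unit_naturality, Linear.smul_comp]

/-- A fully faithful left adjoint of an additive functor preserves indecomposable objects. -/
lemma IsIndecomposable.map_leftAdjoint (adj : H ⊣ T) [T.Additive] [H.Full] [H.Faithful]
    {X : A} (hX : IsIndecomposable X) : IsIndecomposable (H.obj X) := by
  have : H.Additive := adj.left_adjoint_additive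
  refine ⟨fun h => hX.1 ?_, ?_⟩
  · rw [IsZero.iff_id_eq_zero] at h ⊢
    apply H.map_injective
    rw [H.map_id, h, H.map_zero]
  · rintro Y Z b ⟨hb⟩ ⟨i⟩
    -- A retract `W` of $HX$ killed by $T$ is zero, since by adjunction its projection corresponds
    -- to a map $X \to TW = 0$.
    have key {W : B} (p : b.pt ⟶ W) (s : W ⟶ b.pt) (hs : s ≫ p = 𝟙 W)
        (hW : IsZero (T.obj W)) : IsZero W := by
      have h : i.hom ≫ p = 0 := (adj.homEquiv X W).injective (hW.eq_of_tgt _ _)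
      have hp : p = 0 := by rw [← cancel_epi i.hom, h, comp_zero]
      rw [IsZero.iff_id_eq_zero, ← hs, hp, comp_zero]
    have hT : (T.mapBinaryBicone b).IsBilimit := isBinaryBilimitOfTotal _ (by
      have h := congrArg T.map (IsBilimit.binary_total hb)
      rw [T.map_add, T.map_comp, T.map_comp, T.map_id] at h
      exact h)
    -- The unit identifies $X$ with $THX \cong TY \oplus TZ$, so $TY$ or $TZ$ vanishes.
    refine (hX.2 _ _ _ ⟨hT⟩ ⟨asIso (adj.unit.app X) ≪≫ T.mapIso i⟩).imp ?_ ?_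
    · exact key b.fst b.inl b.inl_fst
    · exact key b.snd b.inr b.inr_snd

end LeftAdjoint

/-! ### Restriction of the adjunction to finite-dimensional comodules. -/

namespace RightComodule

section FinDim

variable {K C : Type u} [Field K] [AddCommGroup C] [Module K C] [Coalgebra K C]
  {e : WithConv (C →ₗ[K] K)} (he : IsIdempotentElem e)

/-- The restriction `M ↦ eM` to finite-dimensional comodules. -/
def localizeFinDim : FinDim K C ⥤ FinDim K (LocalizedCoalgebra e he) :=
  ObjectProperty.lift _ ((isFiniteDimensional K C).ι ⋙ localizeFunctor he) fun M => by
    have : FiniteDimensional K M.obj.carrier := M.property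
    exact inferInstanceAs (FiniteDimensional K (LinearMap.range (act e M.obj)))

instance : (localizeFinDim he).Additive where
  map_add {_ _ _ _} := rfl

instance : (localizeFinDim he).Linear K where
  map_smul _ _ := rfl

variable {he} {H : RightComodule K (LocalizedCoalgebra e he) ⥤ RightComodule K C}
  (adj : H ⊣ localizeFunctor he)

/-- The restriction of the colocalizing functor to finite-dimensional comodules. -/
def colocalizeFinDim : FinDim K (LocalizedCoalgebra e he) ⥤ FinDim K C :=
  ObjectProperty.lift _ ((isFiniteDimensional K (LocalizedCoalgebra e he)).ι ⋙ H) fun N =>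
    finiteDimensional_obj adj N.obj N.property

/-- The restricted functors are still adjoint. -/
noncomputable def finDimAdjunction : colocalizeFinDim adj ⊣ localizeFinDim he :=
  adj.restrictFullyFaithful (ObjectProperty.fullyFaithfulι _) (ObjectProperty.fullyFaithfulι _)
    (Iso.refl _) (Iso.refl _)

lemma full_and_faithful_of_adjunction (adj : H ⊣ localizeFunctor he) : H.Full ∧ H.Faithful := by
  have := isIso_unit adj
  exact ⟨adj.fullyFaithfulLOfIsIsoUnit.full, adj.fullyFaithfulLOfIsIsoUnit.faithful⟩

instance : (colocalizeFinDim adj).Full := by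
  have := (full_and_faithful_of_adjunction adj).1
  have : ((isFiniteDimensional K (LocalizedCoalgebra e he)).ι ⋙ H).Full := inferInstance
  exact Functor.Full.of_comp_faithful_iso (ObjectProperty.liftCompιIso _ _ _)

instance : (colocalizeFinDim adj).Faithful := by
  have := (full_and_faithful_of_adjunction adj).2
  have : ((isFiniteDimensional K (LocalizedCoalgebra e he)).ι ⋙ H).Faithful := inferInstance
  exact Functor.Faithful.of_comp_iso (ObjectProperty.liftCompιIso _ _ _)

end FinDim

end RightComodule

theorem mainTheorem7 {K C : Type u} [Field K] [IsAlgClosed K] [AddCommGroup C] [Module K C]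
    [Coalgebra K C] (e : WithConv (C →ₗ[K] K)) (he : IsIdempotentElem e)
    (hperf : IsPerfectColocalizing he)
    (hwild : IsWildComoduleType K (LocalizedCoalgebra e he)) :
    IsWildComoduleType K C := by
  obtain ⟨H, ⟨adj⟩, hexact⟩ := hperf
  obtain ⟨F, _, _, _, hFexact, hFiso, hFind⟩ := hwild
  let G := RightComodule.colocalizeFinDim adj
  have adjG : G ⊣ RightComodule.localizeFinDim he := RightComodule.finDimAdjunction adj
  have : G.Additive := adjG.left_adjoint_additive
  have : G.Linear K := adjG.linear_leftAdjoint K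
  have : G.Full := inferInstanceAs (RightComodule.colocalizeFinDim adj).Full
  have : G.Faithful := inferInstanceAs (RightComodule.colocalizeFinDim adj).Faithful
  refine ⟨F ⋙ G, inferInstance, inferInstance, inferInstance, ?_, ?_, ?_⟩
  -- Only here does exactness of `H` enter; all other properties follow from the adjunction alone.
  · intro X Y Z f g hf hfg hg
    exact hexact _ _ (hFexact f g hf hfg hg)
  · rintro X Y ⟨i⟩
    exact hFiso X Y ⟨G.preimageIso i⟩
  · intro X hX
    exact (hFind X hX).map_leftAdjoint adjG
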